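/- Let $1\le p<\infty$, $p\neq 2$, and let $\ell_p$ be the Banach space of $p$-summable complex sequences. Let $O(\ell_p)$ be the group of linear bijective isometries of $\ell_p$. A topological group $G$ is said to have property $(H_{\ell_p})$ if there is a homomorphism $\pi:G\to O(\ell_p)$ such that $g\mapsto \pi(g)x$ is continuous for every $x\in\ell_p$ and such that (a) (vanishing coefficients) $\lim_{g\to\infty}\langle \pi(g)x,y\rangle=0$ for all $x\in \ell_p$ and all $y$ in the dual space $(\ell_p)^*$; (b) (almost invariant vectors) there is a sequence of unit vectors $\xi_n\in\ell_p$ such that $\|\pi(g)\xi_n-\xi_n\|\to 0$ uniformly on compact subsets of $G$. 1. Let $G$ be a connected second countable locally compact (Hausdorff) group. Then $G$ has property $(H_{\ell_p})$ if and only if $G$ is compact. 2. Let $G$ be a totally disconnected second countable locally compact (Hausdorff) group. If $G$ has property $(H_{\ell_p})$, then $G$ is amenable. Conversely, if $p>1$ and $G$ is amenable, then $G$ has property $(H_{\ell_p})$. In particular, for $p>1$, $G$ has property $(H_{\ell_p})$ if and only if $G$ is amenable. -/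

import Mathlib

open Filter Topology
open scoped ENNReal BoundedContinuousFunction

/-- An orthogonal representation of a topological group `G` on a complex Banach space `B`:
a homomorphism from `G` to the group of linear bijective isometries of `B`
all of whose orbit maps are continuous. -/
structure OrthogonalRep (G B : Type*) [Group G] [TopologicalSpace G]
    [NormedAddCommGroup B] [NormedSpace ℂ B] where
  toHom : G →* (B ≃ₗᵢ[ℂ] B)
  continuous_orbit : ∀ x : B, Continuous fun g : G => toHom g x

namespace OrthogonalRep

variable {G B : Type*} [Group G] [TopologicalSpace G] [NormedAddCommGroup B] [NormedSpace ℂ B]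

/-- Every matrix coefficient `g ↦ ⟨π(g)x, y⟩`, with `x` in `B` and `y` in the dual of `B`,
tends to `0` at infinity on `G`. -/
def VanishingCoefficients (π : OrthogonalRep G B) : Prop :=
  ∀ (x : B) (y : StrongDual ℂ B), Tendsto (fun g : G => y (π.toHom g x)) (cocompact G) (𝓝 0)

/-- There is a sequence of unit vectors `ξ n` such that `‖π(g) ξ n - ξ n‖` tends to `0`
uniformly on compact subsets of `G`. -/
def AlmostInvariantVectors (π : OrthogonalRep G B) : Prop :=
  ∃ ξ : ℕ → B, (∀ n, ‖ξ n‖ = 1) ∧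
    ∀ K : Set G, IsCompact K →
      TendstoUniformlyOn (fun (n : ℕ) (g : G) => ‖π.toHom g (ξ n) - ξ n‖) (fun _ => 0) atTop K

end OrthogonalRep

/-- The property `(H_B)` of a topological group `G`, for a Banach space `B`. -/
def PropertyH (G B : Type*) [Group G] [TopologicalSpace G]
    [NormedAddCommGroup B] [NormedSpace ℂ B] : Prop :=
  ∃ π : OrthogonalRep G B, π.VanishingCoefficients ∧ π.AlmostInvariantVectors

/-- The property `(H_{l_p})`, where `l_p` is the Banach space of `p`-summable complex sequences. -/
def PropertyHlp (G : Type*) [Group G] [TopologicalSpace G] (p : ℝ≥0∞) [Fact (1 ≤ p)] : Prop :=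
  PropertyH G (lp (fun _ : ℕ => ℂ) p)

/-- Amenability of a (locally compact) group: there is a left invariant mean on the space of
bounded continuous real functions on `G`. -/
def IsAmenableGroup (G : Type*) [Group G] [TopologicalSpace G] [IsTopologicalGroup G] : Prop :=
  ∃ m : (G →ᵇ ℝ) →ₗ[ℝ] ℝ,
    m 1 = 1 ∧
    (∀ f : G →ᵇ ℝ, (∀ x, 0 ≤ f x) → 0 ≤ m f) ∧
    ∀ (g : G) (f : G →ᵇ ℝ), m (f.compContinuous ⟨fun x => g * x, continuous_const_mul g⟩) = m f

section Lamperti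

/-- Strict superadditivity of `t ↦ t ^ q` for `q > 1`. -/
lemma rpow_add_rpow_lt_rpow_add {q a b : ℝ} (hq : 1 < q) (ha : 0 < a) (hb : 0 < b) :
    a ^ q + b ^ q < (a + b) ^ q := by
  have hs : 0 < a + b := by positivity
  have key : ∀ t : ℝ, 0 < t → t ^ q = t ^ (q - 1) * t := fun t ht => by
    rw [← Real.rpow_add_one ht.ne', sub_add_cancel]
  rw [key a ha, key b hb, key _ hs, mul_add]
  have h2 : a ^ (q - 1) < (a + b) ^ (q - 1) :=
    Real.rpow_lt_rpow ha.le (by linarith) (by linarith)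
  have h3 : b ^ (q - 1) < (a + b) ^ (q - 1) :=
    Real.rpow_lt_rpow hb.le (by linarith) (by linarith)
  gcongr

/-- Strict subadditivity of `t ↦ t ^ q` for `q < 1`. -/
lemma rpow_add_lt_rpow_add_rpow {q a b : ℝ} (hq : q < 1) (ha : 0 < a) (hb : 0 < b) :
    (a + b) ^ q < a ^ q + b ^ q := by
  have hs : 0 < a + b := by positivity
  have key : ∀ t : ℝ, 0 < t → t ^ q = t ^ (q - 1) * t := fun t ht => by
    rw [← Real.rpow_add_one ht.ne', sub_add_cancel]
  rw [key a ha, key b hb, key _ hs, mul_add]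
  have h2 : (a + b) ^ (q - 1) < a ^ (q - 1) :=
    Real.rpow_lt_rpow_of_neg ha (by linarith) (by linarith)
  have h3 : (a + b) ^ (q - 1) < b ^ (q - 1) :=
    Real.rpow_lt_rpow_of_neg hb (by linarith) (by linarith)
  gcongr

/-- The defect in the parallelogram identity with exponent `r`. -/
noncomputable def clarksonDefect (r : ℝ) (a b : ℂ) : ℝ :=
  ‖a + b‖ ^ r + ‖a - b‖ ^ r - 2 * (‖a‖ ^ r + ‖b‖ ^ r)

lemma clarksonDefect_eq_zero {r : ℝ} (hr : 0 < r) {a b : ℂ} (h : a = 0 ∨ b = 0) :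
    clarksonDefect r a b = 0 := by
  rcases h with rfl | rfl <;> simp [clarksonDefect, Real.zero_rpow hr.ne'] <;> ring

lemma norm_rpow_eq_sq_rpow (r : ℝ) (a : ℂ) : ‖a‖ ^ r = (‖a‖ ^ 2) ^ (r / 2) := by
  rw [← Real.rpow_natCast, ← Real.rpow_mul (norm_nonneg a)]
  congr 1
  push_cast
  ring

lemma parallelogram_half (a b : ℂ) :
    (1 / 2 : ℝ) * ‖a + b‖ ^ 2 + (1 / 2 : ℝ) * ‖a - b‖ ^ 2 = ‖a‖ ^ 2 + ‖b‖ ^ 2 := by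
  have := parallelogram_law_with_norm ℝ a b
  linarith

lemma clarksonDefect_pos {r : ℝ} (hr : 2 < r) {a b : ℂ} (ha : a ≠ 0) (hb : b ≠ 0) :
    0 < clarksonDefect r a b := by
  have h1 := rpow_add_rpow_lt_rpow_add (q := r / 2) (by linarith)
    (a := ‖a‖ ^ 2) (b := ‖b‖ ^ 2) (by positivity) (by positivity)
  have h2 := (convexOn_rpow (p := r / 2) (by linarith)).2
    (Set.mem_Ici.2 (sq_nonneg ‖a + b‖)) (Set.mem_Ici.2 (sq_nonneg ‖a - b‖))
    (one_half_pos (α := ℝ)).le (one_half_pos (α := ℝ)).le (by norm_num)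
  simp only [smul_eq_mul, parallelogram_half] at h2
  simp only [clarksonDefect, norm_rpow_eq_sq_rpow r]
  linarith

lemma clarksonDefect_neg {r : ℝ} (hr0 : 0 < r) (hr : r < 2) {a b : ℂ} (ha : a ≠ 0) (hb : b ≠ 0) :
    clarksonDefect r a b < 0 := by
  have h1 := rpow_add_lt_rpow_add_rpow (q := r / 2) (by linarith)
    (a := ‖a‖ ^ 2) (b := ‖b‖ ^ 2) (by positivity) (by positivity)
  have h2 := (Real.concaveOn_rpow (p := r / 2) (by linarith) (by linarith)).2
    (Set.mem_Ici.2 (sq_nonneg ‖a + b‖)) (Set.mem_Ici.2 (sq_nonneg ‖a - b‖))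
    (one_half_pos (α := ℝ)).le (one_half_pos (α := ℝ)).le (by norm_num)
  simp only [smul_eq_mul, parallelogram_half] at h2
  simp only [clarksonDefect, norm_rpow_eq_sq_rpow r]
  linarith

/-- For `r ≠ 2` the defect has a constant sign and vanishes only if `a = 0` or `b = 0`. -/
lemma exists_clarksonDefect_sign {r : ℝ} (hr0 : 0 < r) (hr : r ≠ 2) :
    ∃ s : ℝ, ∀ a b : ℂ, 0 ≤ s * clarksonDefect r a b ∧
      (s * clarksonDefect r a b = 0 ↔ a = 0 ∨ b = 0) := by
  have aux : ∀ s : ℝ, (∀ a b : ℂ, a ≠ 0 → b ≠ 0 → 0 < s * clarksonDefect r a b) →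
      ∀ a b : ℂ, 0 ≤ s * clarksonDefect r a b ∧
      (s * clarksonDefect r a b = 0 ↔ a = 0 ∨ b = 0) := by
    intro s h a b
    by_cases hab : a = 0 ∨ b = 0
    · simp [clarksonDefect_eq_zero hr0 hab, hab]
    · have h' := hab
      push Not at h'
      exact ⟨(h a b h'.1 h'.2).le, iff_of_false (h a b h'.1 h'.2).ne' hab⟩
  rcases hr.lt_or_gt with h | h
  · exact ⟨-1, aux _ fun a b ha hb => by linarith [clarksonDefect_neg hr0 h ha hb]⟩
  · exact ⟨1, aux _ fun a b ha hb => by linarith [clarksonDefect_pos h ha hb]⟩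

variable {ι : Type*} {p : ℝ≥0∞} [Fact (1 ≤ p)]

lemma toReal_pos_of_one_le (hp : p ≠ ∞) : 0 < p.toReal :=
  ENNReal.toReal_pos (zero_lt_one.trans_le (Fact.out : 1 ≤ p)).ne' hp

/-- For `p ≠ 2`, disjointness of supports in `ℓ^p` is a metric property. -/
lemma lp_disjoint_iff (hp : p ≠ ∞) (hp2 : p ≠ 2) (x y : lp (fun _ : ι => ℂ) p) :
    (∀ i, x i = 0 ∨ y i = 0) ↔
      ‖x + y‖ ^ p.toReal + ‖x - y‖ ^ p.toReal =
        2 * (‖x‖ ^ p.toReal + ‖y‖ ^ p.toReal) := by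
  have hr := toReal_pos_of_one_le hp
  have hr2 : p.toReal ≠ 2 := fun h => hp2 <| by
    rw [← ENNReal.ofReal_toReal hp, h]; simp
  obtain ⟨s, hs⟩ := exists_clarksonDefect_sign hr hr2
  have hsum : HasSum (fun i => s * clarksonDefect p.toReal (x i) (y i))
      (s * (‖x + y‖ ^ p.toReal + ‖x - y‖ ^ p.toReal -
        2 * (‖x‖ ^ p.toReal + ‖y‖ ^ p.toReal))) :=
    ((((lp.hasSum_norm hr (x + y)).add (lp.hasSum_norm hr (x - y))).sub
      (((lp.hasSum_norm hr x).add (lp.hasSum_norm hr y)).mul_left 2))).mul_left s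
  have hs0 : s ≠ 0 := by
    rintro rfl
    simpa using (hs 1 1).2
  constructor
  · intro h
    have h0 : (fun i => s * clarksonDefect p.toReal (x i) (y i)) = fun _ => 0 :=
      funext fun i => (hs _ _).2.2 (h i)
    rw [h0] at hsum
    have := hsum.unique hasSum_zero
    rcases mul_eq_zero.1 this with h | h
    · exact absurd h hs0
    · linarith
  · intro h i
    rw [h, sub_self, mul_zero, hasSum_zero_iff_of_nonneg fun i => (hs _ _).1] at hsum
    exact (hs _ _).2.1 (congrFun hsum i)

lemma lp_disjoint_map_iff (hp : p ≠ ∞) (hp2 : p ≠ 2)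
    (U : lp (fun _ : ι => ℂ) p ≃ₗᵢ[ℂ] lp (fun _ : ι => ℂ) p) (x y : lp (fun _ : ι => ℂ) p) :
    (∀ i, U x i = 0 ∨ U y i = 0) ↔ ∀ i, x i = 0 ∨ y i = 0 := by
  rw [lp_disjoint_iff hp hp2, lp_disjoint_iff hp hp2, ← map_add, ← map_sub]
  simp only [LinearIsometryEquiv.norm_map]

variable [DecidableEq ι]

lemma lp_eq_single_of_forall_ne {κ : Type*} [DecidableEq κ] {q : ℝ≥0∞}
    {x : lp (fun _ : κ => ℂ) q} {i : κ} (h : ∀ j ≠ i, x j = 0) : x = lp.single q i (x i) := by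
  ext j
  by_cases hj : j = i
  · subst hj; simp
  · simp [h j hj, hj]

/-- **Lamperti's theorem** for `ℓ^p`, `p ≠ 2`: a surjective isometry maps each basis vector to a
unimodular multiple of a basis vector. -/
lemma exists_map_single_eq_single (hp : p ≠ ∞) (hp2 : p ≠ 2)
    (U : lp (fun _ : ι => ℂ) p ≃ₗᵢ[ℂ] lp (fun _ : ι => ℂ) p) (i : ι) :
    ∃ (j : ι) (c : ℂ), ‖c‖ = 1 ∧ U (lp.single p i 1) = lp.single p j c := by
  have hp0 : 0 < p := zero_lt_one.trans_le Fact.out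
  have hne : U (lp.single p i 1) ≠ 0 := by
    intro h
    have h1 : ‖U (lp.single p i (1 : ℂ))‖ = 1 := by
      rw [LinearIsometryEquiv.norm_map, lp.norm_single hp0, norm_one]
    simp [h] at h1
  obtain ⟨j, hj⟩ : ∃ j, U (lp.single p i 1) j ≠ 0 := by
    by_contra! h
    exact hne (lp.ext (funext h))
  have h1 : ∀ k ≠ i, U.symm (lp.single p j 1) k = 0 := by
    intro k hk
    have hd : ∀ l, U (lp.single p i 1) l = 0 ∨ U (lp.single p k 1) l = 0 := by
      rw [lp_disjoint_map_iff hp hp2]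
      intro l
      by_cases hl : l = i
      · subst hl; right; simp [hk.symm]
      · left; simp [hl]
    have hd2 : ∀ l, U (U.symm (lp.single p j 1)) l = 0 ∨ U (lp.single p k 1) l = 0 := by
      intro l
      rw [LinearIsometryEquiv.apply_symm_apply]
      by_cases hl : l = j
      · subst hl; exact Or.inr ((hd l).resolve_left hj)
      · left; simp [hl]
    rw [lp_disjoint_map_iff hp hp2] at hd2
    simpa using hd2 k
  have h2 := lp_eq_single_of_forall_ne h1
  set c := U.symm (lp.single p j 1) i
  have h3 : ‖c‖ = 1 := by
    rw [← lp.norm_single (p := p) hp0 i c (E := fun _ : ι => ℂ), ← h2,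
      LinearIsometryEquiv.norm_map, lp.norm_single hp0, norm_one]
  have hc : c ≠ 0 := norm_ne_zero_iff.1 (by rw [h3]; exact one_ne_zero)
  refine ⟨j, c⁻¹, by rw [norm_inv, h3, inv_one], ?_⟩
  have h4 : lp.single p i (1 : ℂ) = c⁻¹ • U.symm (lp.single p j (1 : ℂ)) := by
    rw [h2, ← lp.single_smul, smul_eq_mul, inv_mul_cancel₀ hc]
  rw [h4, map_smul, LinearIsometryEquiv.apply_symm_apply, ← lp.single_smul, smul_eq_mul, mul_one]

/-- The permutation of the indices underlying a surjective isometry of `ℓ^p`. -/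
noncomputable def supportIndex (hp : p ≠ ∞) (hp2 : p ≠ 2)
    (U : lp (fun _ : ι => ℂ) p ≃ₗᵢ[ℂ] lp (fun _ : ι => ℂ) p) (i : ι) : ι :=
  (exists_map_single_eq_single hp hp2 U i).choose

lemma norm_map_single_apply (hp : p ≠ ∞) (hp2 : p ≠ 2)
    (U : lp (fun _ : ι => ℂ) p ≃ₗᵢ[ℂ] lp (fun _ : ι => ℂ) p) (i j : ι) :
    ‖U (lp.single p i 1) j‖ = if supportIndex hp hp2 U i = j then 1 else 0 := by
  obtain ⟨c, hc, h⟩ := (exists_map_single_eq_single hp hp2 U i).choose_spec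
  rw [h]
  change ‖Pi.single (M := fun _ => ℂ) (supportIndex hp hp2 U i) c j‖ = _
  split_ifs with hj
  · subst hj; simp [hc]
  · rw [Pi.single_eq_of_ne' hj, norm_zero]

lemma supportIndex_eq_iff (hp : p ≠ ∞) (hp2 : p ≠ 2)
    (U : lp (fun _ : ι => ℂ) p ≃ₗᵢ[ℂ] lp (fun _ : ι => ℂ) p) (i j : ι) :
    supportIndex hp hp2 U i = j ↔ U (lp.single p i 1) j ≠ 0 := by
  rw [← norm_ne_zero_iff, norm_map_single_apply hp hp2]
  simp

lemma norm_map_apply_supportIndex (hp : p ≠ ∞) (hp2 : p ≠ 2)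
    (U : lp (fun _ : ι => ℂ) p ≃ₗᵢ[ℂ] lp (fun _ : ι => ℂ) p) (x : lp (fun _ : ι => ℂ) p) (i : ι) :
    ‖U x (supportIndex hp hp2 U i)‖ = ‖x i‖ := by
  set j := supportIndex hp hp2 U i with hj
  have hx : x = x i • lp.single p i (1 : ℂ) + (x - x i • lp.single p i (1 : ℂ)) := by abel
  have hd : ∀ l, U (lp.single p i 1) l = 0 ∨ U (x - x i • lp.single p i (1 : ℂ)) l = 0 := by
    rw [lp_disjoint_map_iff hp hp2]
    intro l
    by_cases hl : l = i
    · subst hl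
      right
      change x l - x l * Pi.single (M := fun _ => ℂ) l 1 l = 0
      simp
    · left; simp [hl]
  have h0 : U (x - x i • lp.single p i (1 : ℂ)) j = 0 :=
    (hd j).resolve_left ((supportIndex_eq_iff hp hp2 U i j).1 rfl)
  rw [hx, map_add, map_smul, lp.coeFn_add, Pi.add_apply, h0, add_zero, lp.coeFn_smul,
    Pi.smul_apply, norm_smul, norm_map_single_apply hp hp2, if_pos rfl, mul_one]
  simp

lemma supportIndex_one (hp : p ≠ ∞) (hp2 : p ≠ 2) (i : ι) :
    supportIndex hp hp2 (1 : lp (fun _ : ι => ℂ) p ≃ₗᵢ[ℂ] lp (fun _ : ι => ℂ) p) i = i := by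
  rw [supportIndex_eq_iff]
  simp

lemma supportIndex_mul (hp : p ≠ ∞) (hp2 : p ≠ 2)
    (U V : lp (fun _ : ι => ℂ) p ≃ₗᵢ[ℂ] lp (fun _ : ι => ℂ) p) (i : ι) :
    supportIndex hp hp2 (U * V) i = supportIndex hp hp2 U (supportIndex hp hp2 V i) := by
  rw [supportIndex_eq_iff]
  change U (V _) _ ≠ 0
  rw [← norm_ne_zero_iff,
    norm_map_apply_supportIndex, norm_ne_zero_iff]
  exact (supportIndex_eq_iff hp hp2 V i _).1 rfl

end Lamperti

section IndexAction

variable {G : Type*} [Group G] [TopologicalSpace G] {p : ℝ≥0∞} [Fact (1 ≤ p)]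

/-- The action on the index set underlying an orthogonal representation on `ℓ^p`, `p ≠ 2`. -/
noncomputable abbrev OrthogonalRep.indexAction (π : OrthogonalRep G (lp (fun _ : ℕ => ℂ) p))
    (hp : p ≠ ∞) (hp2 : p ≠ 2) : MulAction G ℕ where
  smul g i := supportIndex hp hp2 (π.toHom g) i
  one_smul i := by
    change supportIndex hp hp2 (π.toHom 1) i = i
    rw [map_one, supportIndex_one]
  mul_smul g h i := by
    change supportIndex hp hp2 (π.toHom (g * h)) i = _
    rw [map_mul, supportIndex_mul]
    rfl

lemma OrthogonalRep.continuous_coefficient_single (π : OrthogonalRep G (lp (fun _ : ℕ => ℂ) p))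
    (i j : ℕ) : Continuous fun g => (π.toHom g (lp.single p i 1) : ℕ → ℂ) j :=
  (lp.evalCLM ℂ (fun _ : ℕ => ℂ) p j).continuous.comp (π.continuous_orbit _)

lemma OrthogonalRep.isClopen_supportIndex_eq (π : OrthogonalRep G (lp (fun _ : ℕ => ℂ) p))
    (hp : p ≠ ∞) (hp2 : p ≠ 2) (i j : ℕ) :
    IsClopen {g | supportIndex hp hp2 (π.toHom g) i = j} := by
  have hc := (π.continuous_coefficient_single i j).norm
  constructor
  · have : {g | supportIndex hp hp2 (π.toHom g) i = j} =
        (fun g => ‖(π.toHom g (lp.single p i 1) : ℕ → ℂ) j‖) ⁻¹' {1} := by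
      ext g
      simp only [Set.mem_ofPred_eq, Set.mem_preimage, Set.mem_singleton_iff,
        norm_map_single_apply hp hp2]
      simp
    rw [this]
    exact isClosed_singleton.preimage hc
  · have : {g | supportIndex hp hp2 (π.toHom g) i = j} =
        (fun g => ‖(π.toHom g (lp.single p i 1) : ℕ → ℂ) j‖) ⁻¹' {0}ᶜ := by
      ext g
      simp only [Set.mem_ofPred_eq, Set.mem_preimage, Set.mem_singleton_iff, Set.mem_compl_iff,
        norm_map_single_apply hp hp2]
      simp
    rw [this]
    exact isClosed_singleton.isOpen_compl.preimage hc

lemma OrthogonalRep.VanishingCoefficients.isCompact_supportIndex_eq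
    {π : OrthogonalRep G (lp (fun _ : ℕ => ℂ) p)} (h : π.VanishingCoefficients)
    (hp : p ≠ ∞) (hp2 : p ≠ 2) (i j : ℕ) :
    IsCompact {g | supportIndex hp hp2 (π.toHom g) i = j} := by
  have h1 := (h (lp.single p i 1) (lp.evalCLM ℂ (fun _ : ℕ => ℂ) p j)).norm
  rw [norm_zero] at h1
  obtain ⟨K, hK, hKs⟩ := mem_cocompact.1 (h1.eventually (gt_mem_nhds one_pos))
  refine hK.of_isClosed_subset (π.isClopen_supportIndex_eq hp hp2 i j).1 fun g hg => ?_
  by_contra hgK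
  have h2 : ‖(π.toHom g (lp.single p i 1) : ℕ → ℂ) j‖ < 1 := hKs hgK
  rw [norm_map_single_apply hp hp2, if_pos (show supportIndex hp hp2 (π.toHom g) i = j from hg)] at h2
  exact lt_irrefl _ h2

/-- A connected group with a representation on `ℓ^p`, `p ≠ 2`, with vanishing coefficients is
compact. -/
lemma OrthogonalRep.VanishingCoefficients.compactSpace [ConnectedSpace G]
    {π : OrthogonalRep G (lp (fun _ : ℕ => ℂ) p)} (h : π.VanishingCoefficients)
    (hp : p ≠ ∞) (hp2 : p ≠ 2) : CompactSpace G := by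
  have h1 := (π.isClopen_supportIndex_eq hp hp2 0 0).eq_univ
    ⟨1, by simp [map_one, supportIndex_one]⟩
  exact ⟨h1 ▸ h.isCompact_supportIndex_eq hp hp2 0 0⟩

lemma propertyHlp_of_compactSpace [CompactSpace G] : PropertyHlp G p := by
  refine ⟨⟨1, fun x => by simpa using continuous_const⟩, ?_, ?_⟩
  · intro x y
    rw [cocompact_eq_bot]
    exact tendsto_bot
  · refine ⟨fun _ => lp.single p 0 1, fun _ => ?_, fun K _ => ?_⟩
    · rw [lp.norm_single (zero_lt_one.trans_le Fact.out), norm_one]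
    · simp only [MonoidHom.one_apply, LinearIsometryEquiv.coe_one, id, sub_self, norm_zero]
      exact tendsto_const_nhds.tendstoUniformlyOn_const K

end IndexAction

section Transfer

open MeasureTheory

variable {G : Type*} [Group G] [TopologicalSpace G] [IsTopologicalGroup G]

/-- An invariant mean on the bounded functions on a discrete space with a group action. -/
def HasInvariantMean (G X : Type*) [Group G] [MulAction G X] [TopologicalSpace X]
    [DiscreteTopology X] : Prop :=
  ∃ M : (X →ᵇ ℝ) →ₗ[ℝ] ℝ, M 1 = 1 ∧ (∀ f : X →ᵇ ℝ, (∀ x, 0 ≤ f x) → 0 ≤ M f) ∧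
    ∀ (g : G) (f : X →ᵇ ℝ),
      M (f.compContinuous ⟨fun x => g • x, continuous_of_discreteTopology⟩) = M f

lemma setAverage_preimage_mul_left [MeasurableSpace G] [BorelSpace G] (μ : Measure G)
    [μ.IsMulLeftInvariant] {E : Type*} [NormedAddCommGroup E] [NormedSpace ℝ E]
    (f : G → E) (g : G) (s : Set G) :
    ⨍ x in (g * ·) ⁻¹' s, f (g * x) ∂μ = ⨍ x in s, f x ∂μ := by
  rw [setAverage_eq, setAverage_eq, measureReal_def, measureReal_def, measure_preimage_mul,
    (measurePreserving_mul_left μ g).setIntegral_preimage_emb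
      (measurableEmbedding_mulLeft g) f s]

lemma abs_setAverage_le {α : Type*} [MeasurableSpace α] (μ : Measure α) {f : α → ℝ} {s : Set α}
    {C : ℝ} (hC : ∀ x, |f x| ≤ C) (hC0 : 0 ≤ C) : |⨍ x in s, f x ∂μ| ≤ C := by
  rw [setAverage_eq, smul_eq_mul, abs_mul, abs_of_nonneg (by positivity)]
  by_cases hs : μ s = ∞
  · simp [measureReal_def, hs, hC0]
  by_cases hs0 : μ s = 0
  · simp [measureReal_def, hs0, hC0]
  have h1 : ‖∫ x in s, f x ∂μ‖ ≤ C * μ.real s :=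
    norm_setIntegral_le_of_norm_le_const (lt_top_iff_ne_top.2 hs) fun x _ => hC x
  have h2 : 0 < μ.real s := ENNReal.toReal_pos hs0 hs
  rw [inv_mul_le_iff₀ h2, mul_comm]
  exact h1

lemma setAverage_add {α : Type*} [MeasurableSpace α] {μ : Measure α} {f g : α → ℝ} {s : Set α}
    (hf : IntegrableOn f s μ) (hg : IntegrableOn g s μ) :
    ⨍ x in s, (f x + g x) ∂μ = ⨍ x in s, f x ∂μ + ⨍ x in s, g x ∂μ := by
  simp only [setAverage_eq]
  rw [integral_add hf hg, smul_add]

lemma setAverage_const_mul {α : Type*} [MeasurableSpace α] {μ : Measure α} (c : ℝ) (f : α → ℝ)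
    (s : Set α) : ⨍ x in s, c * f x ∂μ = c * ⨍ x in s, f x ∂μ := by
  simp only [setAverage_eq, smul_eq_mul]
  rw [integral_const_mul]
  ring

lemma setAverage_nonneg {α : Type*} [MeasurableSpace α] {μ : Measure α} {f : α → ℝ}
    (s : Set α) (hf : ∀ x, 0 ≤ f x) : 0 ≤ ⨍ x in s, f x ∂μ := by
  rw [setAverage_eq]
  exact smul_nonneg (by positivity) (integral_nonneg hf)

lemma BoundedContinuousFunction.integrableOn_of_isCompact {Y : Type*} [TopologicalSpace Y]
    [T2Space Y] [MeasurableSpace Y] [OpensMeasurableSpace Y] {μ : Measure Y}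
    [IsFiniteMeasureOnCompacts μ] (f : Y →ᵇ ℝ) {s : Set Y}
    (hs : IsCompact s) : IntegrableOn f s μ :=
  f.continuous.continuousOn.integrableOn_compact hs

/-- A group acting on a discrete space with compact open stabilizers and an invariant mean is
amenable. -/
lemma isAmenableGroup_of_hasInvariantMean [T2Space G] [LocallyCompactSpace G] {X : Type*}
    [MulAction G X] [TopologicalSpace X] [DiscreteTopology X]
    (ho : ∀ i j : X, IsOpen {g : G | g • i = j}) (hc : ∀ i j : X, IsCompact {g : G | g • i = j})
    (hM : HasInvariantMean G X) : IsAmenableGroup G := by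
  obtain ⟨M, hM1, hM0, hMi⟩ := hM
  borelize G
  let μ : Measure G := Measure.haar
  let r : X → X := fun i => (Quotient.mk (MulAction.orbitRel G X) i).out
  have hr : ∀ i, ∃ g : G, g • r i = i := fun i => by
    have : (MulAction.orbitRel G X) (r i) i := Quotient.exact (Quotient.out_eq _)
    exact MulAction.orbitRel_apply.1 ((MulAction.orbitRel G X).symm this)
  have hrg : ∀ (g : G) i, r (g • i) = r i := fun g i => by
    have : (Quotient.mk (MulAction.orbitRel G X) (g • i)) = Quotient.mk _ i :=
      Quotient.sound (MulAction.orbitRel_apply.2 ⟨g, rfl⟩)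
    simp only [r, this]
  let A : (G →ᵇ ℝ) → X → ℝ := fun f i => ⨍ x in {x : G | x • r i = i}, f x ∂μ
  have hAb : ∀ f i, ‖A f i‖ ≤ ‖f‖ := fun f i =>
    abs_setAverage_le μ (fun x => f.norm_coe_le_norm x) (norm_nonneg f)
  let T : (G →ᵇ ℝ) →ₗ[ℝ] (X →ᵇ ℝ) :=
    { toFun := fun f => .ofNormedAddCommGroup (A f) continuous_of_discreteTopology ‖f‖ (hAb f)
      map_add' := fun f g => by
        ext i
        exact setAverage_add (f.integrableOn_of_isCompact (hc _ _))
          (g.integrableOn_of_isCompact (hc _ _))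
      map_smul' := fun c f => by
        ext i
        exact setAverage_const_mul c f _ }
  refine ⟨M.comp T, ?_, ?_, ?_⟩
  · have : T 1 = 1 := by
      ext i
      obtain ⟨g, hg⟩ := hr i
      exact setAverage_const ((ho (r i) i).measure_pos μ ⟨g, hg⟩).ne' (hc _ _).measure_lt_top.ne 1
    rw [LinearMap.comp_apply, this, hM1]
  · exact fun f hf => hM0 _ fun i => setAverage_nonneg _ hf
  · intro g f
    rw [LinearMap.comp_apply, LinearMap.comp_apply, ← hMi g (T f)]
    congr 1
    ext i
    change ⨍ x in {x : G | x • r i = i}, f (g * x) ∂μ = ⨍ x in {x : G | x • r (g • i) = g • i}, f x ∂μ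
    rw [← setAverage_preimage_mul_left μ f g]
    congr 2
    ext x
    simp [hrg, mul_smul]

end Transfer

section MeanOfAlmostInvariant

variable {ι : Type*} [TopologicalSpace ι] {p : ℝ≥0∞} [Fact (1 ≤ p)]

/-- The integral of a bounded function against the density `|x|^p`, for `x` in `ℓ^p`. -/
noncomputable def weightedSum (x : lp (fun _ : ι => ℂ) p) (F : ι →ᵇ ℝ) : ℝ :=
  ∑' i, F i * ‖x i‖ ^ p.toReal

lemma summable_weightedSum (hp : p ≠ ∞) (x : lp (fun _ : ι => ℂ) p) (F : ι →ᵇ ℝ) :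
    Summable fun i => F i * ‖x i‖ ^ p.toReal := by
  refine ((lp.hasSum_norm (toReal_pos_of_one_le hp) x).summable.mul_left ‖F‖).of_norm_bounded
    fun i => ?_
  rw [norm_mul, Real.norm_of_nonneg (Real.rpow_nonneg (norm_nonneg (x i)) _)]
  gcongr
  exact F.norm_coe_le_norm i

lemma abs_weightedSum_le (hp : p ≠ ∞) (x : lp (fun _ : ι => ℂ) p) (F : ι →ᵇ ℝ) :
    ‖weightedSum x F‖ ≤ ‖F‖ * ‖x‖ ^ p.toReal := by
  refine tsum_of_norm_bounded ((lp.hasSum_norm (toReal_pos_of_one_le hp) x).mul_left ‖F‖)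
    fun i => ?_
  rw [norm_mul, Real.norm_of_nonneg (Real.rpow_nonneg (norm_nonneg (x i)) _)]
  gcongr
  exact F.norm_coe_le_norm i

/-- Integration of a nonnegative function against `|x|^p` is the `p`-th power of the norm of a
continuous linear function of `x`. -/
lemma exists_norm_rpow_eq_weightedSum (hp : p ≠ ∞) (F : ι →ᵇ ℝ) (hF : ∀ i, 0 ≤ F i) :
    ∃ D : lp (fun _ : ι => ℂ) p →L[ℂ] lp (fun _ : ι => ℂ) p,
      ∀ x, ‖D x‖ ^ p.toReal = weightedSum x F := by
  have hr := toReal_pos_of_one_le hp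
  have hT : ∀ i, ‖((F i ^ p.toReal⁻¹ : ℝ) : ℂ) • ContinuousLinearMap.id ℂ ℂ‖ ≤
      ‖F‖ ^ p.toReal⁻¹ := fun i => by
    rw [norm_smul, ContinuousLinearMap.norm_id, mul_one, Complex.norm_real,
      Real.norm_of_nonneg (Real.rpow_nonneg (hF i) _)]
    exact Real.rpow_le_rpow (hF i) ((le_abs_self _).trans (F.norm_coe_le_norm i)) (by positivity)
  refine ⟨lp.mapCLM p _ (Real.rpow_nonneg (norm_nonneg F) _) hT, fun x => ?_⟩
  rw [lp.norm_rpow_eq_tsum hr]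
  refine tsum_congr fun i => ?_
  change ‖((F i ^ p.toReal⁻¹ : ℝ) : ℂ) * x i‖ ^ p.toReal = _
  rw [norm_mul, Real.mul_rpow (norm_nonneg _) (norm_nonneg _), Complex.norm_real,
    Real.norm_of_nonneg (Real.rpow_nonneg (hF i) _), Real.rpow_inv_rpow (hF i) hr.ne']

/-- The mean on bounded functions obtained from a sequence in `ℓ^p` by an ultralimit. -/
noncomputable def limitMean (ξ : ℕ → lp (fun _ : ι => ℂ) p) (F : ι →ᵇ ℝ) : ℝ :=
  limUnder (hyperfilter ℕ : Filter ℕ) fun n => weightedSum (ξ n) F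

lemma tendsto_limitMean (hp : p ≠ ∞) {ξ : ℕ → lp (fun _ : ι => ℂ) p} (hξ : ∀ n, ‖ξ n‖ = 1)
    (F : ι →ᵇ ℝ) :
    Tendsto (fun n => weightedSum (ξ n) F) (hyperfilter ℕ) (𝓝 (limitMean ξ F)) := by
  refine tendsto_nhds_limUnder ?_
  obtain ⟨a, -, ha⟩ := (isCompact_closedBall (0 : ℝ) ‖F‖).ultrafilter_le_nhds'
    ((hyperfilter ℕ).map fun n => weightedSum (ξ n) F)
    (Ultrafilter.mem_map.2 <| univ_mem' fun n => by
      have := abs_weightedSum_le hp (ξ n) F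
      rw [hξ, Real.one_rpow, mul_one] at this
      simpa using this)
  exact ⟨a, ha⟩

lemma limitMean_add (hp : p ≠ ∞) {ξ : ℕ → lp (fun _ : ι => ℂ) p} (hξ : ∀ n, ‖ξ n‖ = 1)
    (F F' : ι →ᵇ ℝ) : limitMean ξ (F + F') = limitMean ξ F + limitMean ξ F' := by
  refine Tendsto.limUnder_eq
    (((tendsto_limitMean hp hξ F).add (tendsto_limitMean hp hξ F')).congr fun n => ?_)
  rw [weightedSum, weightedSum, ← (summable_weightedSum hp _ F).tsum_add
    (summable_weightedSum hp _ F')]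
  exact tsum_congr fun i => by simp [add_mul]

lemma limitMean_smul (hp : p ≠ ∞) {ξ : ℕ → lp (fun _ : ι => ℂ) p} (hξ : ∀ n, ‖ξ n‖ = 1)
    (c : ℝ) (F : ι →ᵇ ℝ) : limitMean ξ (c • F) = c * limitMean ξ F := by
  refine Tendsto.limUnder_eq (((tendsto_limitMean hp hξ F).const_mul c).congr fun n => ?_)
  rw [weightedSum, ← tsum_mul_left]
  exact tsum_congr fun i => by simp [mul_assoc]

lemma limitMean_one (hp : p ≠ ∞) {ξ : ℕ → lp (fun _ : ι => ℂ) p} (hξ : ∀ n, ‖ξ n‖ = 1) :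
    limitMean ξ 1 = 1 := by
  refine Tendsto.limUnder_eq (tendsto_const_nhds.congr fun n => ?_)
  have := lp.norm_rpow_eq_tsum (toReal_pos_of_one_le hp) (ξ n)
  rw [hξ, Real.one_rpow] at this
  rw [this]
  exact tsum_congr fun i => by simp

lemma limitMean_nonneg (hp : p ≠ ∞) {ξ : ℕ → lp (fun _ : ι => ℂ) p} (hξ : ∀ n, ‖ξ n‖ = 1)
    {F : ι →ᵇ ℝ} (hF : ∀ i, 0 ≤ F i) : 0 ≤ limitMean ξ F :=
  ge_of_tendsto' (tendsto_limitMean hp hξ F) fun n => tsum_nonneg fun i =>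
    mul_nonneg (hF i) (by positivity)

lemma limitMean_eq_of_tendsto_sub (hp : p ≠ ∞) {ξ η : ℕ → lp (fun _ : ι => ℂ) p}
    (hξ : ∀ n, ‖ξ n‖ = 1) (h : Tendsto (fun n => ‖η n - ξ n‖) atTop (𝓝 0))
    {F : ι →ᵇ ℝ} (hF : ∀ i, 0 ≤ F i) : limitMean η F = limitMean ξ F := by
  have hr := toReal_pos_of_one_le hp
  obtain ⟨D, hD⟩ := exists_norm_rpow_eq_weightedSum hp F hF
  have h1 := tendsto_limitMean hp hξ F
  simp only [← hD] at h1
  have h2 : Tendsto (fun n => ‖D (ξ n)‖) (hyperfilter ℕ)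
      (𝓝 (limitMean ξ F ^ p.toReal⁻¹)) :=
    (h1.rpow_const (Or.inr (inv_nonneg.2 hr.le))).congr fun n =>
      Real.rpow_rpow_inv (norm_nonneg _) hr.ne'
  have h3 : Tendsto (fun n => D (η n) - D (ξ n)) (hyperfilter ℕ) (𝓝 0) := by
    have h4 : Tendsto (fun n => η n - ξ n) (hyperfilter ℕ) (𝓝 0) :=
      (tendsto_zero_iff_norm_tendsto_zero.2 h).mono_left Nat.hyperfilter_le_atTop
    have h5 := (D.continuous.tendsto 0).comp h4
    rw [map_zero] at h5
    exact h5.congr fun n => map_sub D _ _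
  have h5 : Tendsto (fun n => ‖D (η n)‖) (hyperfilter ℕ)
      (𝓝 (limitMean ξ F ^ p.toReal⁻¹)) := by
    refine tendsto_of_tendsto_of_dist h2 ?_
    refine squeeze_zero (fun _ => dist_nonneg) (fun n => ?_)
      (tendsto_zero_iff_norm_tendsto_zero.1 h3)
    rw [dist_comm, Real.dist_eq]
    exact abs_norm_sub_norm_le _ _
  have h6 := h5.rpow_const (p := p.toReal) (Or.inr hr.le)
  rw [Real.rpow_inv_rpow (limitMean_nonneg hp hξ hF) hr.ne'] at h6
  exact Tendsto.limUnder_eq (by simpa only [← hD] using h6)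

/-- Almost invariant vectors in `ℓ^p` give an invariant mean for the underlying action on the
index set. -/
lemma OrthogonalRep.AlmostInvariantVectors.hasInvariantMean {G : Type*} [Group G]
    [TopologicalSpace G] [DiscreteTopology ι] [MulAction G ι]
    {π : OrthogonalRep G (lp (fun _ : ι => ℂ) p)}
    (hp : p ≠ ∞) (hπ : ∀ g x i, ‖(π.toHom g x : ι → ℂ) (g • i)‖ = ‖x i‖)
    (h : π.AlmostInvariantVectors) : HasInvariantMean G ι := by
  obtain ⟨ξ, hξ, hinv⟩ := h
  have hξg : ∀ g, Tendsto (fun n => ‖π.toHom g (ξ n) - ξ n‖) atTop (𝓝 0) := fun g =>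
    (hinv {g} isCompact_singleton).tendsto_at (Set.mem_singleton g)
  let M : (ι →ᵇ ℝ) →ₗ[ℝ] ℝ :=
    { toFun := limitMean ξ
      map_add' := limitMean_add hp hξ
      map_smul' := limitMean_smul hp hξ }
  refine ⟨M, limitMean_one hp hξ, fun f hf => limitMean_nonneg hp hξ hf, fun g f => ?_⟩
  let τ : C(ι, ι) := ⟨fun x => g • x, continuous_of_discreteTopology⟩
  have hpos : ∀ F : ι →ᵇ ℝ, (∀ i, 0 ≤ F i) → M (F.compContinuous τ) = M F := fun F hF => by
    rw [← show limitMean (fun n => π.toHom g (ξ n)) F = M F from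
      limitMean_eq_of_tendsto_sub hp hξ (hξg g) hF]
    change limUnder _ _ = limUnder _ _
    congr 1
    ext n
    refine Eq.trans ?_ ((MulAction.toPerm g).tsum_eq _)
    refine tsum_congr fun i => ?_
    change F (g • i) * _ = F (g • i) * ‖(π.toHom g (ξ n) : ι → ℂ) (g • i)‖ ^ p.toReal
    rw [hπ]
  have h1 := hpos (f + ‖f‖ • 1) fun i => by
    have := neg_le_of_abs_le (f.norm_coe_le_norm i)
    simp only [BoundedContinuousFunction.coe_add, BoundedContinuousFunction.coe_smul, Pi.add_apply,
      BoundedContinuousFunction.coe_one, Pi.one_apply, smul_eq_mul, mul_one]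
    linarith
  have h2 : (f + ‖f‖ • 1).compContinuous τ = f.compContinuous τ + ‖f‖ • 1 := by
    ext i
    rfl
  rw [h2, map_add, map_add] at h1
  exact add_right_cancel h1

/-- Property `(H_{ℓ_p})`, `p ≠ 2`, implies amenability. -/
lemma PropertyHlp.isAmenableGroup {G : Type*} [Group G] [TopologicalSpace G]
    [IsTopologicalGroup G] [T2Space G] [LocallyCompactSpace G] (hp : p ≠ ∞) (hp2 : p ≠ 2)
    (h : PropertyHlp G p) : IsAmenableGroup G := by
  obtain ⟨π, hv, ha⟩ := h
  let _ := π.indexAction hp hp2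
  exact isAmenableGroup_of_hasInvariantMean (X := ℕ)
    (fun i j => (π.isClopen_supportIndex_eq hp hp2 i j).2)
    (fun i j => hv.isCompact_supportIndex_eq hp hp2 i j)
    (ha.hasInvariantMean hp fun g x i => norm_map_apply_supportIndex hp hp2 _ x i)

end MeanOfAlmostInvariant

section VanDantzig

variable {G : Type*} [Group G] [TopologicalSpace G] [IsTopologicalGroup G] [T2Space G]
  [LocallyCompactSpace G] [TotallyDisconnectedSpace G]

open scoped Pointwise in
/-- **Van Dantzig's theorem**: a totally disconnected locally compact group has a compact open
subgroup. -/
lemma exists_isOpen_isCompact_subgroup :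
    ∃ K : Subgroup G, IsOpen (K : Set G) ∧ IsCompact (K : Set G) := by
  obtain ⟨C, hC, hC1⟩ := exists_compact_mem_nhds (1 : G)
  obtain ⟨U, hU, h1U, hUC⟩ := (loc_compact_Haus_tot_disc_of_zero_dim (H := G)).mem_nhds_iff.1 hC1
  have hUc : IsCompact U := hC.of_isClosed_subset hU.1 hUC
  obtain ⟨V, hV, hVU⟩ := compact_open_separated_mul_left hUc hU.2 subset_rfl
  let K : Subgroup G := MulAction.stabilizer G U
  have hK : IsOpen (K : Set G) := by
    refine K.isOpen_of_mem_nhds (g := 1) (mem_of_superset (inter_mem hV (inv_mem_nhds_one G hV)) ?_)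
    rintro g ⟨hg, hg'⟩
    refine MulAction.mem_stabilizer_iff.2 (Set.Subset.antisymm ?_ ?_)
    · rintro _ ⟨u, hu, rfl⟩
      exact hVU (Set.mul_mem_mul hg hu)
    · intro u hu
      exact Set.mem_smul_set_iff_inv_smul_mem.2 (hVU (Set.mul_mem_mul hg' hu))
  refine ⟨K, hK, hUc.of_isClosed_subset (K.isClosed_of_isOpen hK) fun g hg => ?_⟩
  have h2 : g • U = U := hg
  rw [← h2]
  exact ⟨1, h1U, by simp⟩

/-- A second countable totally disconnected locally compact group acts on `ℕ` with compact open
stabilizers. -/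
lemma exists_action_nat [SecondCountableTopology G] : ∃ _ : MulAction G ℕ,
    ∀ i j : ℕ, IsOpen {g : G | g • i = j} ∧ IsCompact {g : G | g • i = j} := by
  obtain ⟨K, hK, hKc⟩ := exists_isOpen_isCompact_subgroup (G := G)
  have : DiscreteTopology (G ⧸ K) := QuotientGroup.discreteTopology hK
  have : Countable (G ⧸ K) := TopologicalSpace.separableSpace_iff_countable.1 inferInstance
  obtain ⟨e⟩ : Nonempty ((G ⧸ K) × ℕ ≃ ℕ) := nonempty_equiv_of_countable
  let act : MulAction G ℕ :=
    { smul := fun g i => e (g • (e.symm i).1, (e.symm i).2)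
      one_smul := fun i => by
        change e ((1 : G) • (e.symm i).1, (e.symm i).2) = i
        simp
      mul_smul := fun g h i => by
        change e ((g * h) • (e.symm i).1, (e.symm i).2) =
          e (g • (e.symm (e (h • (e.symm i).1, (e.symm i).2))).1,
            (e.symm (e (h • (e.symm i).1, (e.symm i).2))).2)
        simp [mul_smul] }
  refine ⟨act, fun i j => ?_⟩
  obtain ⟨a, ha⟩ := QuotientGroup.mk_surjective (e.symm i).1
  obtain ⟨b, hb⟩ := QuotientGroup.mk_surjective (e.symm j).1
  by_cases hij : (e.symm i).2 = (e.symm j).2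
  · have : {g : G | g • i = j} = (fun g => b⁻¹ * g * a) ⁻¹' (K : Set G) := by
      ext g
      change e (g • (e.symm i).1, (e.symm i).2) = j ↔ b⁻¹ * g * a ∈ K
      rw [← Equiv.eq_symm_apply, Prod.ext_iff, ← ha, ← hb, mul_assoc, ← QuotientGroup.eq, eq_comm]
      simp only [hij, and_true]
      exact Iff.rfl
    rw [this]
    let φ : G ≃ₜ G := (Homeomorph.mulLeft b⁻¹).trans (Homeomorph.mulRight a)
    exact ⟨hK.preimage φ.continuous, φ.isCompact_preimage.2 hKc⟩
  · have : {g : G | g • i = j} = ∅ := by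
      refine Set.eq_empty_of_forall_notMem fun g hg => hij ?_
      have hg' : e (g • (e.symm i).1, (e.symm i).2) = j := hg
      rw [← Equiv.eq_symm_apply, Prod.ext_iff] at hg'
      exact hg'.2
    rw [this]
    exact ⟨isOpen_empty, isCompact_empty⟩

end VanDantzig

section Permutation

variable {ι 𝕜 : Type*} [RCLike 𝕜] {p : ℝ≥0∞} [Fact (1 ≤ p)]

lemma Memℓp.comp_perm (hp : p ≠ ∞) {x : ι → 𝕜} (hx : Memℓp x p) (e : Equiv.Perm ι) :
    Memℓp (x ∘ e) p := by
  have hr := toReal_pos_of_one_le hp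
  rw [memℓp_gen_iff hr] at hx ⊢
  exact e.summable_iff.2 hx

/-- The isometry of `ℓ^p` induced by a permutation of the indices. -/
noncomputable def lpPerm (hp : p ≠ ∞) (e : Equiv.Perm ι) :
    lp (fun _ : ι => 𝕜) p ≃ₗᵢ[𝕜] lp (fun _ : ι => 𝕜) p where
  toFun x := ⟨x ∘ e.symm, (lp.memℓp x).comp_perm hp e.symm⟩
  invFun x := ⟨x ∘ e, (lp.memℓp x).comp_perm hp e⟩
  map_add' _ _ := rfl
  map_smul' _ _ := rfl
  left_inv x := lp.ext (funext fun i => congrArg x (e.symm_apply_apply i))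
  right_inv x := lp.ext (funext fun i => congrArg x (e.apply_symm_apply i))
  norm_map' x := by
    have hr := toReal_pos_of_one_le hp
    rw [lp.norm_eq_tsum_rpow hr, lp.norm_eq_tsum_rpow hr]
    congr 1
    exact e.symm.tsum_eq fun i => ‖x i‖ ^ p.toReal

lemma lpPerm_apply (hp : p ≠ ∞) (e : Equiv.Perm ι) (x : lp (fun _ : ι => 𝕜) p) (i : ι) :
    (lpPerm hp e x : ι → 𝕜) i = x (e.symm i) := rfl

lemma lpPerm_single [DecidableEq ι] (hp : p ≠ ∞) (e : Equiv.Perm ι) (i : ι) (a : 𝕜) :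
    lpPerm hp e (lp.single p i a) = lp.single p (e i) a := by
  ext j
  rw [lpPerm_apply, lp.single_apply, lp.single_apply]
  by_cases h : j = e i
  · subst h; simp
  · rw [Pi.single_eq_of_ne h, Pi.single_eq_of_ne fun h' => h (by simp [← h'])]

/-- The representation of a group on `ℓ^p` induced by an action on the index set. -/
noncomputable def permHom (G ι 𝕜 : Type*) [RCLike 𝕜] {p : ℝ≥0∞} [Fact (1 ≤ p)] [Group G]
    [MulAction G ι] (hp : p ≠ ∞) : G →* (lp (fun _ : ι => 𝕜) p ≃ₗᵢ[𝕜] lp (fun _ : ι => 𝕜) p) where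
  toFun g := lpPerm hp (MulAction.toPerm g)
  map_one' := by
    ext x i
    exact congrArg x (by simp)
  map_mul' g h := by
    ext x i
    change x _ = x _
    simp [mul_smul]

variable {G : Type*} [Group G] [MulAction G ι]

variable [DecidableEq ι]

lemma permHom_single (hp : p ≠ ∞) (g : G) (i : ι) (a : 𝕜) :
    permHom G ι 𝕜 hp g (lp.single p i a) = lp.single p (g • i) a :=
  lpPerm_single hp _ i a

lemma exists_norm_sub_sum_single_lt (hp : p ≠ ∞) (x : lp (fun _ : ι => 𝕜) p) {ε : ℝ} (hε : 0 < ε) :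
    ∃ s : Finset ι, ‖x - ∑ i ∈ s, lp.single p i (x i)‖ < ε := by
  obtain ⟨s, hs⟩ := ((Metric.tendsto_nhds.1 (lp.hasSum_single hp x)) ε hε).exists
  refine ⟨s, ?_⟩
  rwa [dist_eq_norm, norm_sub_rev] at hs

variable [TopologicalSpace G]

lemma continuous_permHom_single (hp : p ≠ ∞) (ho : ∀ i j : ι, IsOpen {g : G | g • i = j})
    (i : ι) (a : 𝕜) : Continuous fun g : G => permHom G ι 𝕜 hp g (lp.single p i a) := by
  simp only [permHom_single]
  let _ : TopologicalSpace ι := ⊥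
  have : DiscreteTopology ι := ⟨rfl⟩
  have h1 : Continuous fun g : G => g • i := continuous_discrete_rng.2 fun j => ho i j
  exact (continuous_of_discreteTopology (f := fun j : ι => lp.single (E := fun _ => 𝕜) p j a)).comp
    h1

lemma continuous_permHom (hp : p ≠ ∞) (ho : ∀ i j : ι, IsOpen {g : G | g • i = j})
    (x : lp (fun _ : ι => 𝕜) p) : Continuous fun g : G => permHom G ι 𝕜 hp g x := by
  refine continuous_of_uniform_approx_of_continuous fun u hu => ?_
  obtain ⟨ε, hε, hu⟩ := Metric.mem_uniformity_dist.1 hu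
  obtain ⟨s, hs⟩ := exists_norm_sub_sum_single_lt hp x hε
  refine ⟨fun g => permHom G ι 𝕜 hp g (∑ i ∈ s, lp.single p i (x i)), ?_, fun g => hu ?_⟩
  · simp only [map_sum]
    exact continuous_finsetSum _ fun i _ => continuous_permHom_single hp ho i (x i)
  · rwa [dist_eq_norm, ← map_sub, LinearIsometryEquiv.norm_map]

end Permutation

section Vanishing

lemma tendsto_smul_cofinite {G ι : Type*} [Group G] [TopologicalSpace G]
    [MulAction G ι] (hc : ∀ i j : ι, IsCompact {g : G | g • i = j}) (i : ι) :
    Tendsto (fun g : G => g • i) (cocompact G) cofinite := by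
  intro s hs
  refine mem_cocompact.2 ⟨⋃ j ∈ sᶜ, {g : G | g • i = j},
    (mem_cofinite.1 hs).isCompact_biUnion fun j _ => hc i j, fun g hg => ?_⟩
  by_contra h
  exact hg (Set.mem_biUnion (show g • i ∈ sᶜ from h) rfl)

variable {ι : Type*} [DecidableEq ι] {p : ℝ≥0∞} [Fact (1 ≤ p)]

/-- The values of a functional on `ℓ^p`, `1 < p < ∞`, at the basis vectors tend to zero. -/
lemma tendsto_dual_single_cofinite (hp : p ≠ ∞) (hp1 : 1 < p)
    (y : StrongDual ℂ (lp (fun _ : ι => ℂ) p)) :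
    Tendsto (fun j => y (lp.single p j 1)) cofinite (𝓝 0) := by
  have hr := toReal_pos_of_one_le hp
  have hr1 : 1 < p.toReal := by
    simpa using (ENNReal.toReal_lt_toReal ENNReal.one_ne_top hp).2 hp1
  rw [Metric.tendsto_nhds]
  intro ε hε
  rw [eventually_cofinite]
  by_contra hinf
  have hbound : ∀ N : ℕ, ε * N ≤ ‖y‖ * (N : ℝ) ^ (p.toReal)⁻¹ := by
    intro N
    obtain ⟨s, hs, hsN⟩ := Set.Infinite.exists_subset_card_eq hinf N
    have hsε : ∀ j ∈ s, ε ≤ ‖y (lp.single p j 1)‖ := fun j hj => by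
      have : ¬ dist (y (lp.single p j 1)) 0 < ε := hs hj
      rwa [dist_zero_right, not_lt] at this
    let c : ι → ℂ := fun j =>
      (starRingEnd ℂ) (y (lp.single p j 1)) / (‖y (lp.single p j 1)‖ : ℂ)
    have hc : ∀ j ∈ s, ‖c j‖ = 1 := fun j hj => by
      have : ‖y (lp.single p j 1)‖ ≠ 0 := (hε.trans_le (hsε j hj)).ne'
      simp only [c, norm_div, RCLike.norm_conj, Complex.norm_real, norm_norm]
      exact div_self this
    have hcy : ∀ j ∈ s, y (lp.single p j (c j)) = (‖y (lp.single p j 1)‖ : ℂ) := fun j hj => by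
      have h0 : (‖y (lp.single p j 1)‖ : ℂ) ≠ 0 := by
        exact_mod_cast (hε.trans_le (hsε j hj)).ne'
      have h1 : (lp.single p j (c j) : lp (fun _ : ι => ℂ) p) = c j • lp.single p j (1 : ℂ) := by
        rw [← lp.single_smul, smul_eq_mul, mul_one]
      rw [h1, map_smul, smul_eq_mul, div_mul_eq_mul_div,
        div_eq_iff h0, mul_comm, Complex.mul_conj, Complex.normSq_eq_norm_sq]
      push_cast
      ring
    have h1 : ‖∑ j ∈ s, lp.single p j (c j)‖ = (N : ℝ) ^ (p.toReal)⁻¹ := by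
      have := lp.norm_sum_single (E := fun _ : ι => ℂ) hr c s
      have h0 : ∑ j ∈ s, ‖c j‖ ^ p.toReal = N := by
        rw [Finset.sum_congr rfl fun j hj => show ‖c j‖ ^ p.toReal = 1 by
          rw [hc j hj, Real.one_rpow], Finset.sum_const, hsN, nsmul_eq_mul, mul_one]
      rw [h0] at this
      rw [← this, Real.rpow_rpow_inv (norm_nonneg _) hr.ne']
    have h2 : ‖y (∑ j ∈ s, lp.single p j (c j))‖ = ∑ j ∈ s, ‖y (lp.single p j 1)‖ := by
      rw [map_sum, Finset.sum_congr rfl hcy, ← Complex.ofReal_sum, Complex.norm_real,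
        Real.norm_of_nonneg (Finset.sum_nonneg fun _ _ => norm_nonneg _)]
    have h3 := y.le_opNorm (∑ j ∈ s, lp.single p j (c j))
    rw [h1, h2] at h3
    have h4 := Finset.card_nsmul_le_sum s _ ε hsε
    rw [hsN, nsmul_eq_mul, mul_comm] at h4
    exact h4.trans h3
  have hlim : Tendsto (fun N : ℕ => ‖y‖ * (N : ℝ) ^ (-(1 - (p.toReal)⁻¹))) atTop (𝓝 (‖y‖ * 0)) :=
    ((tendsto_rpow_neg_atTop (sub_pos.2 (inv_lt_one_of_one_lt₀ hr1))).comp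
      tendsto_natCast_atTop_atTop).const_mul _
  rw [mul_zero] at hlim
  obtain ⟨N, hN, hN0⟩ := ((hlim.eventually (gt_mem_nhds hε)).and (eventually_gt_atTop 0)).exists
  have hN0' : (0 : ℝ) < N := by exact_mod_cast hN0
  have h5 := hbound N
  rw [neg_sub, Real.rpow_sub_one hN0'.ne', mul_div_assoc', div_lt_iff₀ hN0'] at hN
  linarith

variable {G : Type*} [Group G] [TopologicalSpace G] [MulAction G ι]

/-- The permutation representation on `ℓ^p` of an action with open stabilizers. -/
noncomputable def permRep (hp : p ≠ ∞) (ho : ∀ i j : ι, IsOpen {g : G | g • i = j}) :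
    OrthogonalRep G (lp (fun _ : ι => ℂ) p) :=
  ⟨permHom G ι ℂ hp, continuous_permHom hp ho⟩

lemma permRep_vanishingCoefficients (hp : p ≠ ∞) (hp1 : 1 < p)
    (ho : ∀ i j : ι, IsOpen {g : G | g • i = j}) (hc : ∀ i j : ι, IsCompact {g : G | g • i = j}) :
    (permRep (p := p) hp ho).VanishingCoefficients := by
  intro x y
  have h1 : ∀ i (a : ℂ), Tendsto (fun g : G => y (permHom G ι ℂ hp g (lp.single p i a)))
      (cocompact G) (𝓝 0) := fun i a => by
    have := ((tendsto_dual_single_cofinite hp hp1 y).comp (tendsto_smul_cofinite hc i)).const_mul a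
    rw [mul_zero] at this
    refine this.congr fun g => ?_
    rw [permHom_single, ← smul_eq_mul, Function.comp_apply, ← map_smul, ← lp.single_smul,
      smul_eq_mul, mul_one]
  rw [Metric.tendsto_nhds]
  intro ε hε
  have hy : 0 < ‖y‖ + 1 := by positivity
  obtain ⟨s, hs⟩ := exists_norm_sub_sum_single_lt hp x (div_pos (half_pos hε) hy)
  have h2 : Tendsto (fun g : G => y (permHom G ι ℂ hp g (∑ i ∈ s, lp.single p i (x i))))
      (cocompact G) (𝓝 0) := by
    simp only [map_sum]
    simpa using tendsto_finsetSum s fun i _ => h1 i (x i)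
  filter_upwards [Metric.tendsto_nhds.1 h2 _ (half_pos hε)] with g hg
  rw [dist_zero_right] at hg ⊢
  have h3 : ‖y (permHom G ι ℂ hp g (x - ∑ i ∈ s, lp.single p i (x i)))‖ ≤ ε / 2 := by
    refine (y.le_opNorm _).trans ?_
    rw [LinearIsometryEquiv.norm_map]
    calc ‖y‖ * _ ≤ (‖y‖ + 1) * (ε / 2 / (‖y‖ + 1)) := by gcongr; linarith
      _ = ε / 2 := mul_div_cancel₀ _ hy.ne'
  change ‖y (permHom G ι ℂ hp g x)‖ < ε
  rw [map_sub, map_sub] at h3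
  have h4 := norm_le_norm_sub_add (y (permHom G ι ℂ hp g x))
    (y (permHom G ι ℂ hp g (∑ i ∈ s, lp.single p i (x i))))
  linarith

end Vanishing

section TopologicalInvariance

open MeasureTheory

variable {G : Type*} [Group G] [TopologicalSpace G] [IsTopologicalGroup G]
  [MeasurableSpace G] [BorelSpace G]

/-- Averages against a left Haar measure over right translates. -/
lemma setAverage_preimage_mul_right [LocallyCompactSpace G] [SecondCountableTopology G]
    (μ : Measure G) [μ.IsHaarMeasure] {E : Type*}
    [NormedAddCommGroup E] [NormedSpace ℝ E] (f : G → E) (g : G) (s : Set G) :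
    ⨍ x in (· * g) ⁻¹' s, f (x * g) ∂μ = ⨍ x in s, f x ∂μ := by
  have hemb : MeasurableEmbedding (fun x : G => x * g) := measurableEmbedding_mulRight g
  have hmap := Measure.isMulLeftInvariant_eq_smul (μ.map (· * g)) μ
  set c := Measure.haarScalarFactor (μ.map (· * g)) μ with hc
  have hc0 : (c : ℝ) ≠ 0 := by
    have : c ≠ 0 := by
      intro h0
      rw [h0, zero_smul] at hmap
      have h1 : μ.map (· * g) Set.univ = 0 := by rw [hmap]; rfl
      rw [Measure.map_apply hemb.measurable MeasurableSet.univ, Set.preimage_univ] at h1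
      exact (isOpen_univ.measure_pos μ Set.univ_nonempty).ne' h1
    exact_mod_cast this
  have h1 : μ.real ((· * g) ⁻¹' s) = c * μ.real s := by
    rw [measureReal_def, ← hemb.map_apply, hmap, Measure.smul_apply, ENNReal.smul_def, smul_eq_mul,
      ENNReal.toReal_mul, measureReal_def]
    rfl
  have h2 : ∫ x in (· * g) ⁻¹' s, f (x * g) ∂μ = (c : ℝ) • ∫ x in s, f x ∂μ := by
    rw [← hemb.setIntegral_map, hmap, Measure.restrict_smul, integral_smul_nnreal_measure]
    rfl
  rw [setAverage_eq, setAverage_eq, h1, h2, smul_smul, mul_inv, mul_right_comm,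
    inv_mul_cancel₀ hc0, one_mul]

variable [T2Space G]

/-- The average over a compact set which is a union of left cosets of an open subgroup is a finite
mean of averages over these cosets. -/
lemma exists_setAverage_eq_sum (μ : Measure G) [μ.IsHaarMeasure] {S : Set G} (hS : IsCompact S)
    (hne : S.Nonempty) {L : Subgroup G} (hL : IsOpen (L : Set G))
    (hSL : ∀ s ∈ S, ∀ l ∈ L, s * l ∈ S) :
    ∃ T : Finset G, T.Nonempty ∧ ∀ f : G → ℝ, Continuous f →
      ⨍ k in S, f k ∂μ = (T.card : ℝ)⁻¹ * ∑ t ∈ T, ⨍ l in (L : Set G), f (t * l) ∂μ := by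
  classical
  have : DiscreteTopology (G ⧸ L) := QuotientGroup.discreteTopology hL
  have hfin : ((QuotientGroup.mk : G → G ⧸ L) '' S).Finite :=
    (hS.image QuotientGroup.continuous_mk).finite_of_discrete
  let Q : Finset (G ⧸ L) := hfin.toFinset
  have hinj : Function.Injective (Quotient.out : G ⧸ L → G) := Quotient.out_injective
  let T : Finset G := Q.image Quotient.out
  have hpre : ∀ t : G, (QuotientGroup.mk : G → G ⧸ L) ⁻¹' {(t : G ⧸ L)} =
      (t⁻¹ * ·) ⁻¹' (L : Set G) := fun t => by
    ext x
    simp only [Set.mem_preimage, Set.mem_singleton_iff, SetLike.mem_coe]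
    rw [eq_comm, QuotientGroup.eq]
  have hcl : IsClosed (L : Set G) := L.isClosed_of_isOpen hL
  have hSU : S = ⋃ t ∈ T, (t⁻¹ * ·) ⁻¹' (L : Set G) := by
    ext x
    simp only [T, Q, Set.mem_iUnion, Finset.mem_image, Set.Finite.mem_toFinset]
    constructor
    · intro hx
      refine ⟨_, ⟨(x : G ⧸ L), ⟨x, hx, rfl⟩, rfl⟩, ?_⟩
      rw [← hpre]
      simp
    · rintro ⟨t, ⟨q, ⟨s, hs, rfl⟩, rfl⟩, hx⟩
      rw [← hpre, Set.mem_preimage, QuotientGroup.out_eq', Set.mem_singleton_iff, eq_comm,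
        QuotientGroup.eq] at hx
      have := hSL s hs _ hx
      rwa [mul_inv_cancel_left] at this
  have hmeas : ∀ t ∈ T, MeasurableSet ((t⁻¹ * ·) ⁻¹' (L : Set G)) := fun t _ =>
    (hL.preimage (continuous_const_mul t⁻¹)).measurableSet
  have hdisj : Set.Pairwise (T : Set G)
      (Function.onFun Disjoint fun t => (t⁻¹ * ·) ⁻¹' (L : Set G)) := by
    intro a ha b hb hab
    simp only [T, Finset.coe_image, Set.mem_image] at ha hb
    obtain ⟨q, -, rfl⟩ := ha
    obtain ⟨q', -, rfl⟩ := hb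
    rw [Function.onFun, ← hpre, ← hpre]
    refine Disjoint.preimage _ (Set.disjoint_singleton.2 fun h => hab ?_)
    rw [QuotientGroup.out_eq', QuotientGroup.out_eq'] at h
    rw [h]
  have hTS : ∀ t ∈ T, (t⁻¹ * ·) ⁻¹' (L : Set G) ⊆ S := fun t ht => by
    rw [hSU]
    exact Set.subset_biUnion_of_mem (u := fun t => (t⁻¹ * ·) ⁻¹' (L : Set G)) ht
  have hint : ∀ f : G → ℝ, Continuous f →
      ∫ k in S, f k ∂μ = ∑ t ∈ T, ∫ l in (L : Set G), f (t * l) ∂μ := by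
    intro f hf
    have hfS : IntegrableOn f S μ := hf.continuousOn.integrableOn_compact hS
    conv_lhs => rw [hSU]
    rw [integral_biUnion_finset T hmeas hdisj fun t ht => hfS.mono_set (hTS t ht)]
    refine Finset.sum_congr rfl fun t _ => ?_
    rw [← (measurePreserving_mul_left μ t⁻¹).setIntegral_preimage_emb
      (measurableEmbedding_mulLeft t⁻¹) (fun l => f (t * l)) L]
    simp
  have hreal : μ.real S = T.card * μ.real (L : Set G) := by
    have := hint (fun _ => 1) continuous_const
    simpa using this
  have hTne : T.Nonempty := by
    obtain ⟨s, hs⟩ := hne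
    exact ⟨_, Finset.mem_image_of_mem _ (hfin.mem_toFinset.2 ⟨s, hs, rfl⟩)⟩
  refine ⟨T, hTne, fun f hf => ?_⟩
  simp only [setAverage_eq, smul_eq_mul]
  rw [hint f hf, hreal, mul_inv, mul_assoc, Finset.mul_sum]

variable [LocallyCompactSpace G] [SecondCountableTopology G]

/-- The average of the left translates of a bounded continuous function over a compact set. -/
noncomputable def translateAverage (μ : Measure G) [μ.IsHaarMeasure] {S : Set G}
    (hS : IsCompact S) : (G →ᵇ ℝ) →ₗ[ℝ] (G →ᵇ ℝ) where
  toFun f := .ofNormedAddCommGroup (fun x => ⨍ k in S, f (k⁻¹ * x) ∂μ)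
    (by
      simp only [setAverage_eq, smul_eq_mul]
      exact continuous_const.mul (continuous_parametric_integral_of_continuous (μ := μ)
        (f := fun x k => f (k⁻¹ * x)) (by fun_prop) hS))
    ‖f‖ fun x => abs_setAverage_le μ (fun k => f.norm_coe_le_norm _) (norm_nonneg f)
  map_add' f g := by
    ext x
    exact setAverage_add
      ((f.continuous.comp (by fun_prop)).continuousOn.integrableOn_compact hS)
      ((g.continuous.comp (by fun_prop)).continuousOn.integrableOn_compact hS)
  map_smul' c f := by
    ext x
    exact setAverage_const_mul c (fun k => f (k⁻¹ * x)) S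

lemma translateAverage_apply (μ : Measure G) [μ.IsHaarMeasure] {S : Set G}
    (hS : IsCompact S) (f : G →ᵇ ℝ) (x : G) :
    translateAverage μ hS f x = ⨍ k in S, f (k⁻¹ * x) ∂μ := rfl

lemma mean_translateAverage_eq (μ : Measure G) [μ.IsHaarMeasure] {m : (G →ᵇ ℝ) →ₗ[ℝ] ℝ}
    (hm : ∀ (g : G) (f : G →ᵇ ℝ),
      m (f.compContinuous ⟨fun x => g * x, continuous_const_mul g⟩) = m f)
    {S : Set G} (hS : IsCompact S)
    (hne : S.Nonempty) {L : Subgroup G} (hL : IsOpen (L : Set G)) (hLc : IsCompact (L : Set G))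
    (hSL : ∀ s ∈ S, ∀ l ∈ L, s * l ∈ S) (f : G →ᵇ ℝ) :
    m (translateAverage μ hS f) = m (translateAverage μ hLc f) := by
  obtain ⟨T, hT, hsum⟩ := exists_setAverage_eq_sum μ hS hne hL hSL
  have h1 : translateAverage μ hS f = (T.card : ℝ)⁻¹ • ∑ t ∈ T,
      (translateAverage μ hLc f).compContinuous ⟨fun x => t⁻¹ * x, continuous_const_mul t⁻¹⟩ := by
    ext x
    rw [translateAverage_apply, hsum (fun k => f (k⁻¹ * x)) (by fun_prop)]
    simp only [BoundedContinuousFunction.coe_smul, BoundedContinuousFunction.coe_sum,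
      Finset.sum_apply, smul_eq_mul]
    congr 1
    refine Finset.sum_congr rfl fun t _ => ?_
    change _ = translateAverage μ hLc f (t⁻¹ * x)
    simp only [translateAverage_apply, mul_inv_rev, mul_assoc]
  have hT0 : (T.card : ℝ) ≠ 0 := by exact_mod_cast hT.card_ne_zero
  rw [h1, map_smul, map_sum, Finset.sum_congr rfl fun t _ => hm t⁻¹ _, Finset.sum_const,
    nsmul_eq_mul, smul_eq_mul, inv_mul_cancel_left₀ hT0]

/-- On an amenable group with a compact open subgroup `K` there is an invariant mean which is
bounded below by any lower bound of the averages over `K`. -/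
lemma IsAmenableGroup.exists_mean (μ : Measure G) [μ.IsHaarMeasure] (h : IsAmenableGroup G)
    {K : Subgroup G} (hK : IsOpen (K : Set G)) (hKc : IsCompact (K : Set G)) :
    ∃ M : (G →ᵇ ℝ) →ₗ[ℝ] ℝ,
      (∀ (f : G →ᵇ ℝ) (c : ℝ), (∀ x, c ≤ ⨍ k in (K : Set G), f (k⁻¹ * x) ∂μ) → c ≤ M f) ∧
      ∀ (g : G) (f : G →ᵇ ℝ),
        M (f.compContinuous ⟨fun x => g * x, continuous_const_mul g⟩) = M f := by
  obtain ⟨m, hm1, hm0, hmi⟩ := h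
  refine ⟨m.comp (translateAverage μ hKc), fun f c hc => ?_, fun g f => ?_⟩
  · have := hm0 (translateAverage μ hKc f - c • 1) fun x => by
      have := hc x
      simp only [BoundedContinuousFunction.coe_sub, BoundedContinuousFunction.coe_smul,
        Pi.sub_apply, BoundedContinuousFunction.coe_one, Pi.one_apply, smul_eq_mul, mul_one,
        translateAverage_apply]
      linarith
    rw [map_sub, map_smul, hm1, smul_eq_mul, mul_one] at this
    rw [LinearMap.comp_apply]
    linarith
  · have hS : IsCompact ((· * g) ⁻¹' (K : Set G)) :=
      (Homeomorph.mulRight g).isCompact_preimage.2 hKc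
    have h1 : translateAverage μ hKc
        (f.compContinuous ⟨fun x => g * x, continuous_const_mul g⟩) = translateAverage μ hS f := by
      ext x
      rw [translateAverage_apply, translateAverage_apply,
        ← setAverage_preimage_mul_right μ (fun k => f (k⁻¹ * x)) g⁻¹]
      have h2 : (fun x => x * g⁻¹) ⁻¹' ((· * g) ⁻¹' (K : Set G)) = K := by
        ext; simp
      rw [h2]
      simp [mul_assoc]
    let L : Subgroup G := K ⊓ K.comap (MulAut.conj g⁻¹).toMonoidHom
    have hcont : Continuous (MulAut.conj g⁻¹).toMonoidHom := by
      change Continuous fun x => g⁻¹ * x * g⁻¹⁻¹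
      fun_prop
    have hL : IsOpen (L : Set G) := hK.inter (hK.preimage hcont)
    have hLc : IsCompact (L : Set G) :=
      hKc.of_isClosed_subset (L.isClosed_of_isOpen hL) Set.inter_subset_left
    rw [LinearMap.comp_apply, LinearMap.comp_apply, h1,
      mean_translateAverage_eq μ hmi hS ⟨g⁻¹, by simp⟩ hL hLc,
      mean_translateAverage_eq μ hmi hKc ⟨1, K.one_mem⟩ hL hLc]
    · exact fun s hs l hl => K.mul_mem hs hl.1
    · intro s hs l hl
      have h2 : g⁻¹ * l * g⁻¹⁻¹ ∈ K := hl.2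
      have h3 : s * g ∈ K := hs
      change s * l * g ∈ K
      have := K.mul_mem h3 h2
      simpa [mul_assoc] using this

end TopologicalInvariance

section Reiter

open MeasureTheory

variable {G : Type*} [Group G] [TopologicalSpace G] [IsTopologicalGroup G] [T2Space G]
  [LocallyCompactSpace G] [SecondCountableTopology G] [MeasurableSpace G] [BorelSpace G]

/-- The matrix coefficients of a vector with continuous orbit map. -/
noncomputable def coefficientMap {E : Type*} [NormedAddCommGroup E] [NormedSpace ℝ E]
    (π : G →* (E ≃ₗᵢ[ℝ] E)) (v : E) (hv : Continuous fun g => π g v) :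
    StrongDual ℝ E →ₗ[ℝ] (G →ᵇ ℝ) where
  toFun η := .ofNormedAddCommGroup (fun x => η (π x v)) (η.continuous.comp hv) (‖η‖ * ‖v‖)
    fun x => by simpa using η.le_opNorm (π x v)
  map_add' _ _ := rfl
  map_smul' _ _ := rfl

/-- An isometric representation of an amenable group has almost invariant vectors in every convex
set that contains the averages over a compact open subgroup of the vectors of some orbit. -/
lemma IsAmenableGroup.exists_almostInvariant (μ : Measure G) [μ.IsHaarMeasure]
    (h : IsAmenableGroup G) {K : Subgroup G} (hK : IsOpen (K : Set G))
    (hKc : IsCompact (K : Set G)) {E : Type*} [NormedAddCommGroup E] [NormedSpace ℝ E]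
    [CompleteSpace E] (π : G →* (E ≃ₗᵢ[ℝ] E)) {v : E} (hv : Continuous fun g => π g v)
    {C : Set E} (hC : Convex ℝ C) (hvC : ∀ x, ⨍ k in (K : Set G), π (k⁻¹ * x) v ∂μ ∈ C)
    (F : Finset G) {ε : ℝ} (hε : 0 < ε) : ∃ f ∈ C, ∀ g ∈ F, ‖π g f - f‖ < ε := by
  obtain ⟨M, hMc, hMi⟩ := h.exists_mean μ hK hKc
  let A : G → E →L[ℝ] E := fun g => ((π g).toContinuousLinearEquiv : E →L[ℝ] E)
  let T : E →L[ℝ] (F → E) := ContinuousLinearMap.pi fun g => A g - ContinuousLinearMap.id ℝ E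
  by_cases h0 : (0 : F → E) ∈ closure (T '' C)
  · obtain ⟨_, ⟨f, hf, rfl⟩, hfε⟩ := Metric.mem_closure_iff.1 h0 ε hε
    refine ⟨f, hf, fun g hg => ?_⟩
    rw [dist_zero_left] at hfε
    exact (norm_le_pi_norm (T f) ⟨g, hg⟩).trans_lt hfε
  · exfalso
    obtain ⟨Φ, u, hu0, hu⟩ := geometric_hahn_banach_point_closed
      (hC.linear_image T.toLinearMap).closure isClosed_closure h0
    rw [map_zero] at hu0
    let N : StrongDual ℝ E →ₗ[ℝ] ℝ := M.comp (coefficientMap π v hv)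
    have hNi : ∀ (g : G) (η : StrongDual ℝ E), N (η.comp (A g)) = N η := fun g η => by
      refine Eq.trans (congrArg M ?_) (hMi g _)
      ext x
      change η (π g (π x v)) = η (π (g * x) v)
      rw [map_mul]
      rfl
    have hN0 : N (Φ.comp T) = 0 := by
      classical
      let Ψ : F → StrongDual ℝ E := fun g =>
        Φ.comp (ContinuousLinearMap.single ℝ (fun _ : F => E) g)
      have h1 : Φ.comp T = ∑ g : F, ((Ψ g).comp (A g) - Ψ g) := by
        ext x
        rw [_root_.sum_apply]
        change Φ (T x) = ∑ g : F, (Φ (Pi.single g (A g x)) - Φ (Pi.single g x))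
        conv_lhs => rw [← Finset.univ_sum_single (T x), map_sum]
        refine Finset.sum_congr rfl fun g _ => ?_
        rw [← map_sub, ← Pi.single_sub]
        rfl
      rw [h1, map_sum]
      exact Finset.sum_eq_zero fun g _ => by rw [map_sub, hNi, sub_self]
    have hNu : u ≤ N (Φ.comp T) := by
      refine hMc _ u fun x => ?_
      have h1 := hu _ (subset_closure (Set.mem_image_of_mem T (hvC x)))
      refine h1.le.trans_eq ?_
      have h2 : IntegrableOn (fun k => π (k⁻¹ * x) v) K μ :=
        (hv.comp (f := fun k => k⁻¹ * x) (by fun_prop)).continuousOn.integrableOn_compact hKc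
      have h3 := (Φ.comp T).integral_comp_comm h2
      rw [setAverage_eq, setAverage_eq]
      change (Φ.comp T) _ = _
      rw [map_smul, ← h3]
      rfl
    linarith

/-- The probability vectors in `ℓ^1` which are invariant under a subgroup `K`. -/
def invariantProbabilities {H : Type*} [Group H] (ι : Type*) [MulAction H ι] (K : Subgroup H) :
    Set (lp (fun _ : ι => ℝ) 1) :=
  {f | (∀ i, 0 ≤ f i) ∧ lp.tsumCLM ℝ ι ℝ f = 1 ∧
    ∀ k ∈ K, permHom H ι ℝ ENNReal.one_ne_top k f = f}

lemma convex_invariantProbabilities {H : Type*} [Group H] (ι : Type*) [MulAction H ι]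
    (K : Subgroup H) : Convex ℝ (invariantProbabilities ι K) := by
  rintro f ⟨hf0, hf1, hfK⟩ g ⟨hg0, hg1, hgK⟩ a b ha hb hab
  refine ⟨fun i => add_nonneg (mul_nonneg ha (hf0 i)) (mul_nonneg hb (hg0 i)), ?_, fun k hk => ?_⟩
  · rw [map_add, map_smul, map_smul, hf1, hg1, smul_eq_mul, smul_eq_mul, mul_one, mul_one, hab]
  · rw [map_add, map_smul, map_smul, hfK k hk, hgK k hk]

variable {ι : Type*} [DecidableEq ι] [MulAction G ι]

lemma setAverage_mem_invariantProbabilities (μ : Measure G) [μ.IsHaarMeasure] {K : Subgroup G}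
    (hK : IsOpen (K : Set G)) (hKc : IsCompact (K : Set G))
    (ho : ∀ i j : ι, IsOpen {g : G | g • i = j}) (o : ι) (x : G) :
    ⨍ k in (K : Set G), permHom G ι ℝ ENNReal.one_ne_top (k⁻¹ * x) (lp.single 1 o 1) ∂μ ∈
      invariantProbabilities ι K := by
  have hint : IntegrableOn (fun k => permHom G ι ℝ ENNReal.one_ne_top (k⁻¹ * x)
      (lp.single 1 o (1 : ℝ))) K μ :=
    ((continuous_permHom_single ENNReal.one_ne_top ho o 1).comp (f := fun k => k⁻¹ * x)
      (by fun_prop)).continuousOn.integrableOn_compact hKc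
  have hcomm : ∀ η : StrongDual ℝ (lp (fun _ : ι => ℝ) 1),
      η (⨍ k in (K : Set G), permHom G ι ℝ ENNReal.one_ne_top (k⁻¹ * x) (lp.single 1 o 1) ∂μ) =
      ⨍ k in (K : Set G), η (permHom G ι ℝ ENNReal.one_ne_top (k⁻¹ * x) (lp.single 1 o 1)) ∂μ := by
    intro η
    rw [setAverage_eq, setAverage_eq, map_smul, η.integral_comp_comm hint]
  refine ⟨fun i => ?_, ?_, fun h hh => ?_⟩
  · change 0 ≤ lp.evalCLM ℝ (fun _ : ι => ℝ) 1 i _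
    rw [hcomm]
    refine setAverage_nonneg _ fun k => ?_
    change 0 ≤ (permHom G ι ℝ ENNReal.one_ne_top (k⁻¹ * x) (lp.single 1 o 1) : ι → ℝ) i
    rw [permHom_single, lp.single_apply]
    exact (Pi.single_nonneg (α := fun _ : ι => ℝ)).2 zero_le_one i
  · rw [hcomm]
    have h1 : ∀ i : ι, lp.tsumCLM ℝ ι ℝ (lp.single 1 i 1) = 1 := fun i => by
      change ∑' j, Pi.single (M := fun _ => ℝ) i 1 j = 1
      exact tsum_pi_single i 1
    simp only [permHom_single, h1]
    exact setAverage_const (hK.measure_pos μ ⟨1, K.one_mem⟩).ne' hKc.measure_lt_top.ne 1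
  · let A : lp (fun _ : ι => ℝ) 1 →L[ℝ] lp (fun _ : ι => ℝ) 1 :=
      ((permHom G ι ℝ ENNReal.one_ne_top h).toContinuousLinearEquiv :
        lp (fun _ : ι => ℝ) 1 →L[ℝ] lp (fun _ : ι => ℝ) 1)
    change A _ = _
    rw [setAverage_eq, map_smul, ← A.integral_comp_comm hint, ← setAverage_eq, ← setAverage_eq,
      ← setAverage_preimage_mul_right μ
      (fun k => permHom G ι ℝ ENNReal.one_ne_top (k⁻¹ * x) (lp.single 1 o (1 : ℝ))) h⁻¹ K]
    have h2 : (fun x => x * h⁻¹) ⁻¹' (K : Set G) = K := by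
      ext y
      exact K.mul_mem_cancel_right (K.inv_mem hh)
    rw [h2]
    congr 1
    ext1 k
    change permHom G ι ℝ ENNReal.one_ne_top h _ = _
    simp [permHom_single]

/-- Reiter's condition: an amenable group acting with open stabilizers has almost invariant
probability vectors, uniformly on compact sets. -/
lemma IsAmenableGroup.exists_reiter (h : IsAmenableGroup G) {K : Subgroup G}
    (hK : IsOpen (K : Set G)) (hKc : IsCompact (K : Set G)) [Nonempty ι]
    (ho : ∀ i j : ι, IsOpen {g : G | g • i = j}) {Q : Set G} (hQ : IsCompact Q) {ε : ℝ}
    (hε : 0 < ε) : ∃ f : lp (fun _ : ι => ℝ) 1, (∀ i, 0 ≤ f i) ∧ ∑' i, f i = 1 ∧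
      ∀ g ∈ Q, ‖permHom G ι ℝ ENNReal.one_ne_top g f - f‖ < ε := by
  classical
  obtain ⟨o⟩ := ‹Nonempty ι›
  obtain ⟨F, -, hF⟩ := hQ.elim_nhds_subcover (fun g => (g⁻¹ * ·) ⁻¹' (K : Set G)) fun g _ =>
    (hK.preimage (continuous_const_mul g⁻¹)).mem_nhds (by simp)
  obtain ⟨f, ⟨hf0, hf1, hfK⟩, hfF⟩ := h.exists_almostInvariant Measure.haar hK hKc
    (permHom G ι ℝ ENNReal.one_ne_top) (continuous_permHom_single ENNReal.one_ne_top ho o 1)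
    (convex_invariantProbabilities ι K)
    (setAverage_mem_invariantProbabilities Measure.haar hK hKc ho o) F hε
  refine ⟨f, hf0, hf1, fun q hq => ?_⟩
  obtain ⟨g, hg, hgq⟩ := Set.mem_iUnion₂.1 (hF hq)
  have h1 : permHom G ι ℝ ENNReal.one_ne_top q f = permHom G ι ℝ ENNReal.one_ne_top g f := by
    conv_rhs => rw [← hfK _ hgq]
    change _ = (permHom G ι ℝ ENNReal.one_ne_top g * permHom G ι ℝ ENNReal.one_ne_top (g⁻¹ * q)) f
    rw [← map_mul, mul_inv_cancel_left]
  rw [h1]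
  exact hfF g hg

end Reiter

section Converse

lemma abs_rpow_inv_sub_rpow_le {r a b : ℝ} (hr : 1 ≤ r) (ha : 0 ≤ a) (hb : 0 ≤ b) :
    |a ^ r⁻¹ - b ^ r⁻¹| ^ r ≤ |a - b| := by
  wlog hab : b ≤ a generalizing a b
  · rw [abs_sub_comm, abs_sub_comm a]
    exact this hb ha (le_of_not_ge hab)
  have hr0 : r ≠ 0 := by positivity
  have h1 : b ^ r⁻¹ ≤ a ^ r⁻¹ := Real.rpow_le_rpow hb hab (by positivity)
  rw [abs_of_nonneg (sub_nonneg.2 h1), abs_of_nonneg (sub_nonneg.2 hab)]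
  have h2 := Real.add_rpow_le_rpow_add (sub_nonneg.2 h1) (Real.rpow_nonneg hb r⁻¹) hr
  rw [sub_add_cancel, Real.rpow_inv_rpow ha hr0, Real.rpow_inv_rpow hb hr0] at h2
  linarith

variable {ι : Type*} {p : ℝ≥0∞} [Fact (1 ≤ p)] {G : Type*} [Group G] [MulAction G ι]

/-- The Mazur map: the `p`-th root of a probability vector is a unit vector of `ℓ^p`. -/
lemma exists_rpow_inv_vector (hp : p ≠ ∞) (f : lp (fun _ : ι => ℝ) 1) (hf : ∀ i, 0 ≤ f i)
    (hf1 : ∑' i, f i = 1) : ∃ ξ : lp (fun _ : ι => ℂ) p, ‖ξ‖ = 1 ∧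
      ∀ g : G, ‖permHom G ι ℂ hp g ξ - ξ‖ ^ p.toReal ≤
        ‖permHom G ι ℝ ENNReal.one_ne_top g f - f‖ := by
  have hr := toReal_pos_of_one_le hp
  have hr1 : 1 ≤ p.toReal := by
    simpa using (ENNReal.toReal_le_toReal ENNReal.one_ne_top hp).2 (Fact.out : 1 ≤ p)
  have hn : ∀ i, ‖((f i ^ p.toReal⁻¹ : ℝ) : ℂ)‖ ^ p.toReal = f i := fun i => by
    rw [Complex.norm_real, Real.norm_of_nonneg (Real.rpow_nonneg (hf i) _),
      Real.rpow_inv_rpow (hf i) hr.ne']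
  have hsum : Summable f := (lp.memℓp f).summable_of_one
  let ξ : lp (fun _ : ι => ℂ) p := ⟨fun i => ((f i ^ p.toReal⁻¹ : ℝ) : ℂ), memℓp_gen (by
    simpa only [hn] using hsum)⟩
  refine ⟨ξ, ?_, fun g => ?_⟩
  · rw [lp.norm_eq_tsum_rpow hr, show (∑' i, ‖ξ i‖ ^ p.toReal) = 1 from
      (tsum_congr hn).trans hf1, Real.one_rpow]
  · have h1 := lp.hasSum_norm hr (permHom G ι ℂ hp g ξ - ξ)
    have h2 := lp.hasSum_norm (by simp) (permHom G ι ℝ ENNReal.one_ne_top g f - f)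
    simp only [ENNReal.toReal_one, Real.rpow_one] at h2
    refine hasSum_le (fun i => ?_) h1 h2
    change ‖((f (g⁻¹ • i) ^ p.toReal⁻¹ : ℝ) : ℂ) - ((f i ^ p.toReal⁻¹ : ℝ) : ℂ)‖ ^ p.toReal ≤
      ‖f (g⁻¹ • i) - f i‖
    rw [← Complex.ofReal_sub, Complex.norm_real]
    exact abs_rpow_inv_sub_rpow_le hr1 (hf _) (hf _)

/-- An amenable second countable totally disconnected locally compact group has property
`(H_{ℓ_p})` for `1 < p < ∞`. -/
lemma IsAmenableGroup.propertyHlp {G : Type*} [Group G] [TopologicalSpace G]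
    [IsTopologicalGroup G] [T2Space G] [LocallyCompactSpace G] [SecondCountableTopology G]
    [TotallyDisconnectedSpace G] (hp : p ≠ ∞) (hp1 : 1 < p) (h : IsAmenableGroup G) :
    PropertyHlp G p := by
  borelize G
  obtain ⟨act, hact⟩ := exists_action_nat (G := G)
  obtain ⟨K, hK, hKc⟩ := exists_isOpen_isCompact_subgroup (G := G)
  have ho : ∀ i j : ℕ, IsOpen {g : G | g • i = j} := fun i j => (hact i j).1
  have hr := toReal_pos_of_one_le hp
  let Q := CompactExhaustion.choice G
  have hex : ∀ n : ℕ, ∃ ξ : lp (fun _ : ℕ => ℂ) p, ‖ξ‖ = 1 ∧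
      ∀ g ∈ Q n, ‖permHom G ℕ ℂ hp g ξ - ξ‖ < 1 / ((n : ℝ) + 1) := fun n => by
    have hn : 0 < 1 / ((n : ℝ) + 1) := Nat.one_div_pos_of_nat
    obtain ⟨f, hf0, hf1, hfQ⟩ := h.exists_reiter hK hKc ho (Q.isCompact n)
      (Real.rpow_pos_of_pos hn p.toReal)
    obtain ⟨ξ, hξ, hξf⟩ := exists_rpow_inv_vector (G := G) hp f hf0 hf1
    exact ⟨ξ, hξ, fun g hg => (Real.rpow_lt_rpow_iff (norm_nonneg _) hn.le hr).1
      ((hξf g).trans_lt (hfQ g hg))⟩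
  choose ξ hξ hξQ using hex
  refine ⟨permRep hp ho, permRep_vanishingCoefficients hp hp1 ho fun i j => (hact i j).2, ξ, hξ,
    fun C hC => ?_⟩
  obtain ⟨m, hm⟩ := Q.exists_superset_of_isCompact hC
  rw [Metric.tendstoUniformlyOn_iff]
  intro ε hε
  filter_upwards [eventually_ge_atTop m,
    tendsto_one_div_add_atTop_nhds_zero_nat.eventually (gt_mem_nhds hε)] with n hn hnε g hg
  rw [dist_zero_left, norm_norm]
  exact (hξQ n g (Q.subset hn (hm hg))).trans hnε

end Converse

theorem theorem3p4 (p : ℝ≥0∞) [Fact (1 ≤ p)] (hp_top : p ≠ ∞) (hp_two : p ≠ 2) :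
    (∀ (G : Type*) [Group G] [TopologicalSpace G] [IsTopologicalGroup G] [T2Space G]
        [LocallyCompactSpace G] [SecondCountableTopology G] [ConnectedSpace G],
        PropertyHlp G p ↔ CompactSpace G) ∧
    (∀ (G : Type*) [Group G] [TopologicalSpace G] [IsTopologicalGroup G] [T2Space G]
        [LocallyCompactSpace G] [SecondCountableTopology G] [TotallyDisconnectedSpace G],
        (PropertyHlp G p → IsAmenableGroup G) ∧
        (1 < p → IsAmenableGroup G → PropertyHlp G p)) := by
  refine ⟨fun G => ?_, fun G => ?_⟩
  · intro _ _ _ _ _ _ _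
    exact ⟨fun ⟨_, hv, _⟩ => hv.compactSpace hp_top hp_two, fun _ => propertyHlp_of_compactSpace⟩
  · intro _ _ _ _ _ _ _
    exact ⟨fun h => h.isAmenableGroup hp_top hp_two, fun h1 h => h.propertyHlp hp_top h1⟩
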